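/- Let $p$ be an odd prime and let $G$ be a finite group of order $16p$ whose Sylow $p$-subgroup is normal in $G$. Let $G' = [G,G]$ be the commutator subgroup of $G$, and assume that $G/G' \cong \mathbb{Z}_2 \times \mathbb{Z}_2 \times \mathbb{Z}_2$. Then for every generating set $S$ of $G$ the Cayley graph $\mathrm{Cay}(G;S)$ (the simple graph with vertex set $G$ in which two distinct elements $u, v$ are adjacent if and only if $u^{-1}v \in S$ or $v^{-1}u \in S$) has a hamiltonian cycle. -/

import Mathlib

/-! Let t generate the normal Sylow subgroup and let Q be a complement, of order 16. The
automorphism group of ⟨t⟩ is abelian and G/G' has exponent two, so each element of G either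
centralizes or inverts t (`NormalSetting.conj_t`). Moreover Q ∩ G' = {1, z} with z central in Q, and
all squares and commutators of Q lie there. Some a ∈ S inverts t, and Q can be chosen to contain it.
Choose b, c ∈ S so that a, b, c are independent in G/G', and write them as a, t^r b, t^s c with the
new b, c in Q. Eight bits then determine the multiplication (`NormalSetting.exists_frame`), and Q is
nonabelian because z ∈ G'.

A word of length 16 that is a Hamiltonian cycle modulo ⟨t⟩ has product t^(xr + ys), its voltage. If
the voltage is nontrivial, repeating the word p times gives a Hamiltonian cycle of G (the factor
group lemma). For all but four sets of bits there are two such words whose voltages have determinant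
± a power of 2, so both can vanish only if p divides r and s. In the four remaining cases the
determinant has one further prime factor, 7 or 3; for that p the congruences fix the ratio r : s,
and an explicit cycle through all of G is checked.

If b and c both lie in Q, some s ∈ S lies outside Q. Either s can replace one of a, b, c, or its
Q-part is limited to 1, z, a, az, and words in four generators or a traversal of the cosets of ⟨t⟩
finish the proof (`NormalSetting.exists_isHamiltonianCycle_of_complement`). -/

/-- A closed sequence that enumerates all vertices and whose consecutive terms are adjacent is a
Hamiltonian cycle. -/
theorem SimpleGraph.exists_isHamiltonianCycle_of_seq {V : Type*} [Fintype V] [DecidableEq V]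
    (Γ : SimpleGraph V) {n : ℕ} (hn : 3 ≤ n) (hcard : Fintype.card V = n) (f : ℕ → V)
    (hinj : ∀ i < n, ∀ j < n, f i = f j → i = j) (hclosed : f n = f 0)
    (hadj : ∀ i < n, Γ.Adj (f i) (f (i + 1))) :
    ∃ (v : V) (c : Γ.Walk v v), c.IsHamiltonianCycle := by
  obtain ⟨m, rfl⟩ : ∃ m, n = m + 3 := ⟨n - 3, by omega⟩
  have hstep : ∀ u v : Fin (m + 3), v - u = 1 → Γ.Adj (f u) (f v) := by
    intro u v h
    obtain rfl : v = u + 1 := by rw [← h]; abel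
    have h1 := hadj u u.2
    -- The last vertex is the only place where addition in `Fin` wraps around; there `hclosed` is
    -- needed.
    by_cases hu : u = Fin.last (m + 2)
    · subst hu
      simp only [Fin.val_last] at h1
      rw [show m + 2 + 1 = m + 3 from rfl, hclosed] at h1
      simpa using h1
    · rwa [Fin.val_add_one_of_lt (Fin.lt_last_iff_ne_last.2 hu)]
  let φ : SimpleGraph.cycleGraph (m + 3) →g Γ :=
    { toFun := fun i => f i
      map_rel' := by
        intro u v h
        rcases SimpleGraph.cycleGraph_adj.1 h with h | h
        · exact (hstep _ _ h).symm
        · exact hstep _ _ h }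
  have hφ : Function.Bijective φ := by
    rw [Fintype.bijective_iff_injective_and_card]
    refine ⟨fun u v h => Fin.ext (hinj _ u.2 _ v.2 h), by simp [hcard]⟩
  refine ⟨_, (SimpleGraph.cycleGraph.cycle m).map φ, SimpleGraph.Walk.IsHamiltonianCycle.map hφ ?_⟩
  rw [SimpleGraph.Walk.isHamiltonianCycle_iff_isCycle_and_length_eq]
  exact ⟨SimpleGraph.cycleGraph.isCycle_cycle, by simp⟩

/-- A closed enumeration of a group in which consecutive terms differ by right multiplication by
an element of `S` or its inverse is a Hamiltonian cycle of the Cayley graph. -/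
theorem exists_isHamiltonianCycle_mulCayley {G : Type*} [Group G] [Fintype G] [DecidableEq G]
    (S : Set G) {n : ℕ} (hn : 3 ≤ n) (hcard : Nat.card G = n) (f : ℕ → G)
    (hinj : ∀ i < n, ∀ j < n, f i = f j → i = j) (hclosed : f n = f 0)
    (hstep : ∀ i < n, ∃ g, (g ∈ S ∨ g⁻¹ ∈ S) ∧ f (i + 1) = f i * g) :
    ∃ (v : G) (c : (SimpleGraph.mulCayley S).Walk v v), c.IsHamiltonianCycle := by
  refine SimpleGraph.exists_isHamiltonianCycle_of_seq _ hn (by rw [← hcard, Nat.card_eq_fintype_card])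
    f hinj hclosed fun i hi => ?_
  rw [SimpleGraph.mulCayley_adj]
  obtain ⟨g, hg, hf⟩ := hstep i hi
  refine ⟨fun h => ?_, ?_⟩
  · rcases Nat.lt_or_ge (i + 1) n with h1 | h1
    · have := hinj _ hi _ h1 h; omega
    · have : i + 1 = n := by omega
      rw [this, hclosed] at h
      have := hinj _ hi _ (by omega) h; omega
  · rw [hf]; simpa using hg

/-! ### Computable model of the group -/

/-- Squares and commutators (`true` meaning the central involution) of three generators of a group
of order 16 with central quotient data of exponent two, together with the signs by which the second
and the third generator act on the normal subgroup of odd order; the first one acts by `-1`. -/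
structure QuadData where
  (qa qb qc ab ac bc xb xc : Bool)

/-- The tuple `(i, j, k, l)` stands for the normal form `z ^ l * a ^ i * b ^ j * c ^ k`. -/
abbrev QState := Bool × Bool × Bool × Bool

/-- The tuple `(q, u, v)` stands for `t ^ (u * r + v * s) * q`, where `t` generates the normal
subgroup and `r`, `s` are fixed exponents. -/
abbrev Elt := QState × ℤ × ℤ

namespace QuadData

variable (D : QuadData)

/-- Right multiplication of a normal form by `a`: passing `c` and `b` costs their commutators with
`a`, and meeting an `a` already present costs its square. -/
def mulA : QState → QState
  | (i, j, k, l) => (!i, j, k, l ^^ (i && D.qa) ^^ (j && D.ab) ^^ (k && D.ac))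

def mulB : QState → QState
  | (i, j, k, l) => (i, !j, k, l ^^ (j && D.qb) ^^ (k && D.bc))

def mulC : QState → QState
  | (i, j, k, l) => (i, j, !k, l ^^ (k && D.qc))

def mul (q g : QState) : QState :=
  let q := (q.1, q.2.1, q.2.2.1, q.2.2.2 ^^ g.2.2.2)
  let q := bif g.1 then D.mulA q else q
  let q := bif g.2.1 then D.mulB q else q
  bif g.2.2.1 then D.mulC q else q

/-- Every element is its own inverse modulo the central involution, so only the last bit needs
correction, by the value of the square. -/
def inv (q : QState) : QState :=
  (q.1, q.2.1, q.2.2.1, q.2.2.2 ^^ (D.mul q q).2.2.2)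

def sgn (q : QState) : Bool := q.1 ^^ (q.2.1 && D.xb) ^^ (q.2.2.1 && D.xc)

def mulElt (s g : Elt) : Elt :=
  (D.mul s.1 g.1, bif D.sgn s.1 then s.2.1 - g.2.1 else s.2.1 + g.2.1,
    bif D.sgn s.1 then s.2.2 - g.2.2 else s.2.2 + g.2.2)

def invElt (s : Elt) : Elt :=
  (D.inv s.1, bif D.sgn s.1 then s.2.1 else -s.2.1, bif D.sgn s.1 then s.2.2 else -s.2.2)

end QuadData

/-- Matching on the bit hands `f` a literal, so unevaluated terms do not pile up in kernel
reduction. -/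
def forceBool {α : Type*} (b : Bool) (f : Bool → α) : α := match b with
  | true => f true
  | false => f false

theorem forceBool_eq {α : Type*} (b : Bool) (f : Bool → α) : forceBool b f = f b := by
  cases b <;> rfl

/-- Function application that makes the kernel evaluate the argument first. -/
def Elt.force {α : Type*} (s : Elt) (f : Elt → α) : α :=
  forceBool s.1.1 fun i => forceBool s.1.2.1 fun j => forceBool s.1.2.2.1 fun k =>
    forceBool s.1.2.2.2 fun l => f ((i, j, k, l), s.2)

theorem Elt.force_eq {α : Type*} (s : Elt) (f : Elt → α) : s.force f = f s := by
  simp [Elt.force, forceBool_eq]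

/-- Multiply `s` successively by the elements of a list, checking that the codes of all partial
products other than the last one are distinct and not in the bit mask. -/
def QuadData.trace (D : QuadData) (code : Elt → ℕ) : List Elt → Elt → ℕ → Option Elt
  | [], s, _ => some s
  | g :: L, s, mask => bif mask.testBit (code s) then none else
      (D.mulElt s g).force fun s' => D.trace code L s' (mask ||| 2 ^ code s)

/-- The last `k` decimal digits of `n`, starting with the last one. -/
def digitList : ℕ → ℕ → List ℕ
  | 0, _ => []
  | k + 1, n => n % 10 :: digitList k (n / 10)

/-- Digits `1` to `4` denote four elements, digits `5` to `8` their inverses. -/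
def QuadData.letter (D : QuadData) (g₁ g₂ g₃ g₄ : Elt) : ℕ → Elt
  | 1 => g₁
  | 2 => g₂
  | 3 => g₃
  | 4 => g₄
  | 5 => D.invElt g₁
  | 6 => D.invElt g₂
  | 7 => D.invElt g₃
  | _ => D.invElt g₄

namespace QState
def one : QState := (false, false, false, false)
def a : QState := (true, false, false, false)
def b : QState := (false, true, false, false)
def c : QState := (false, false, true, false)
def z : QState := (false, false, false, true)

def code (q : QState) : ℕ :=
  (bif q.1 then 1 else 0) + (bif q.2.1 then 2 else 0) + (bif q.2.2.1 then 4 else 0) +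
    (bif q.2.2.2 then 8 else 0)

end QState

/-- The exponents of the product of a word that is a Hamiltonian cycle modulo the normal
subgroup. -/
def QuadData.voltage (D : QuadData) (f : ℕ → Elt) (w : ℕ) : Option (ℤ × ℤ) :=
  match D.trace (fun s => s.1.code) ((digitList 16 w).map f) (QState.one, 0, 0) 0 with
  | some ((false, false, false, false), t) => some t
  | _ => none

/-! ### Explicit words and their verification by computation -/

def wordsThree : List ℕ :=
  [1232527212325272, 6353231363532313, 7635713572317531, 2563612561272561,
   2763276563276321, 3675723672313672, 2761232127612321, 6367532723275367,
   5766616663616652, 1755563175535611, 6123256525636121, 3631723136317231,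
   2317752577132121, 3121212131212121, 3131312131313121]

def wordsFour : List ℕ :=
  [8341424143414241, 3414241434182111, 2438283124382831, 4124183141281431,
   2444311121113111, 2328232123242321, 3132223421283222, 2323232823232321,
   2328212423212121, 3221342132213121, 3123243121333121]

def wordsOne : List ℕ :=
  [3121312131213121, 3111211131112111, 3121212131212121, 3231213122213121,
   3131312131313121, 3321312133213121]

/-- The generators `a`, `t ^ r * b`, `t ^ s * c` and their inverses. -/
def QuadData.letterThree (D : QuadData) : ℕ → Elt :=
  D.letter (QState.a, 0, 0) (QState.b, 1, 0) (QState.c, 0, 1) (QState.a, 0, 0)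

/-- The generators `a`, `b`, `c`, `t ^ r * d` and their inverses. -/
def QuadData.letterFour (D : QuadData) (d : QState) : ℕ → Elt :=
  D.letter (QState.a, 0, 0) (QState.b, 0, 0) (QState.c, 0, 0) (d, 1, 0)

/-- The elements `t ^ (-r) * a`, `t ^ (-r) * b`, `t ^ (-r) * c`. -/
def letterOne : ℕ → Elt
  | 1 => (QState.a, -1, 0)
  | 2 => (QState.b, -1, 0)
  | _ => (QState.c, -1, 0)

/-- Dividing 1024 makes the determinant ± a power of two, hence invertible modulo every odd prime;
two such voltages vanish together only when both exponents vanish. -/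
def QuadData.checkThree (D : QuadData) : Bool :=
  let vs := wordsThree.filterMap (D.voltage D.letterThree)
  vs.any fun x => vs.any fun y => decide ((x.1 * y.2 - x.2 * y.1) ∣ 1024)

def QuadData.checkFour (D : QuadData) (d : QState) : Bool :=
  wordsFour.any fun w => match D.voltage (D.letterFour d) w with
    | some x => decide (x.1 ∣ 1024)
    | none => false

/-- Here the voltage has to vanish. The letter t^(-r) g is the net effect of p - 1 steps by t^r
followed by a step by g, so the word describes the entry points into successive cosets of ⟨t⟩, and
these must close up. -/
def QuadData.checkOne (D : QuadData) : Bool :=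
  wordsOne.any fun w => match D.voltage letterOne w with
    | some x => decide (x.1 = 0)
    | none => false

/-- The four sets of data in which words of length 16 do not suffice. -/
def QuadData.exceptional : QuadData → Bool
  | ⟨qa, qb, qc, ab, ac, bc, xb, xc⟩ => !qa && !qb && !qc && xb && xc &&
    ((ab && !ac && !bc) || (!ab && ac && !bc) || (!ab && !ac && bc) || (ab && ac && bc))

theorem checkOne_eq_true : ∀ qa qb qc ab ac bc xb xc : Bool, (ab || ac || bc) = true →
    QuadData.checkOne ⟨qa, qb, qc, ab, ac, bc, xb, xc⟩ = true := by
  decide +kernel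

theorem checkThree_eq_true : ∀ qa qb qc ab ac bc xb xc : Bool, (ab || ac || bc) = true →
    QuadData.exceptional ⟨qa, qb, qc, ab, ac, bc, xb, xc⟩ = false →
    QuadData.checkThree ⟨qa, qb, qc, ab, ac, bc, xb, xc⟩ = true := by
  decide +kernel

theorem checkFour_z_eq_true : ∀ qa qb qc ab ac bc xb xc : Bool, (ab || ac || bc) = true →
    QuadData.checkFour ⟨qa, qb, qc, ab, ac, bc, xb, xc⟩ QState.z = true := by
  decide +kernel

/-- Only data in which `b` and `c` centralize `t` are needed: otherwise one of them can take over
the role of `a`. -/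
theorem checkFour_a_eq_true : ∀ qa qb qc ab ac bc e : Bool, (ab || ac || bc) = true →
    QuadData.checkFour ⟨qa, qb, qc, ab, ac, bc, false, false⟩ (true, false, false, e) = true := by
  decide +kernel

/-- Whether the four-fold repetition of a word is a Hamiltonian cycle, when the exponents `u`, `v`
of the second and the third generator are considered modulo `p`. -/
def QuadData.checkFull (D : QuadData) (p : ℕ) (u v : ℤ) (n w : ℕ) : Bool :=
  match D.trace (fun s => s.1.code + 16 * ((s.2.1 * u + s.2.2 * v) % (p : ℤ)).toNat)
    ((List.replicate 4 ((digitList n w).map D.letterThree)).flatten)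
    (QState.one, 0, 0) 0 with
  | some ((false, false, false, false), x, y) => decide ((p : ℤ) ∣ x * u + y * v)
  | _ => false

/-- For each exceptional set of data only one prime survives, 7 or 3, and there the vanishing of
both voltages fixes the ratio of the exponents. These are the constants `u`, `v`; the word has
length 4p, so its fourth power has length 16p. -/
theorem checkFull_ab :
    QuadData.checkFull ⟨false, false, false, true, false, false, true, true⟩ 7 2 1 28
      3212121212121231212121212121 = true := by decide +kernel

theorem checkFull_ac :
    QuadData.checkFull ⟨false, false, false, false, true, false, true, true⟩ 7 1 2 28
      3131313131312313131313131321 = true := by decide +kernel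

theorem checkFull_bc :
    QuadData.checkFull ⟨false, false, false, false, false, true, true, true⟩ 7 1 (-1) 28
      3232323232323123232323232321 = true := by decide +kernel

theorem checkFull_all :
    QuadData.checkFull ⟨false, false, false, true, true, true, true, true⟩ 3 1 2 12
      321212312121 = true := by decide +kernel

/-- In the exceptional cases two words have voltages whose determinant is a power of 2 times 7
or 3. -/
theorem voltage_ab :
    let D : QuadData := ⟨false, false, false, true, false, false, true, true⟩
    D.voltage D.letterThree 3212121232121212 = some (8, -2) ∧
      D.voltage D.letterThree 3121212131212121 = some (-6, -2) := by decide +kernel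

theorem voltage_ac :
    let D : QuadData := ⟨false, false, false, false, true, false, true, true⟩
    D.voltage D.letterThree 3131312131313121 = some (-2, -6) ∧
      D.voltage D.letterThree 2313131323131313 = some (-2, 8) := by decide +kernel

theorem voltage_bc :
    let D : QuadData := ⟨false, false, false, false, false, true, true, true⟩
    D.voltage D.letterThree 3232321232323212 = some (8, -6) ∧
      D.voltage D.letterThree 2323231323232313 = some (-6, 8) := by decide +kernel

theorem voltage_all :
    let D : QuadData := ⟨false, false, false, true, true, true, true, true⟩
    D.voltage D.letterThree 3212321232123212 = some (8, -4) ∧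
      D.voltage D.letterThree 1312131213121312 = some (4, 4) := by decide +kernel

/-! ### Soundness of the model -/

/-- Elements `t`, `a`, `b`, `c`, `z` of a group that satisfy the relations encoded by `D`. -/
structure QuadData.Frame (D : QuadData) {G : Type*} [Group G] (t a b c z : G) : Prop where
  zt : Commute z t
  za : Commute z a
  zb : Commute z b
  zc : Commute z c
  zz : z * z = 1
  aa : a * a = bif D.qa then z else 1
  bb : b * b = bif D.qb then z else 1
  cc : c * c = bif D.qc then z else 1
  ba : b * a = (bif D.ab then z else 1) * (a * b)
  ca : c * a = (bif D.ac then z else 1) * (a * c)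
  cb : c * b = (bif D.bc then z else 1) * (b * c)
  at_inv : a * t * a⁻¹ = t⁻¹
  bt : b * t * b⁻¹ = bif D.xb then t⁻¹ else t
  ct : c * t * c⁻¹ = bif D.xc then t⁻¹ else t

/-- `g` or `1`. -/
def bitPow {G : Type*} [Group G] (g : G) (i : Bool) : G := bif i then g else 1

/-- The value of a normal form. -/
def QState.val {G : Type*} [Group G] (a b c z : G) (q : QState) : G :=
  bitPow z q.2.2.2 * bitPow a q.1 * bitPow b q.2.1 * bitPow c q.2.2.1

/-- The value of a normal form together with exponents. -/
def Elt.val {G : Type*} [Group G] (t a b c z : G) (r s : ℤ) (e : Elt) : G :=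
  t ^ (e.2.1 * r + e.2.2 * s) * QState.val a b c z e.1

section

variable {G : Type*} [Group G]

theorem bitPow_true (g : G) : bitPow g true = g := rfl

theorem Commute.bitPow_left {z g : G} (h : Commute z g) (i : Bool) : Commute (bitPow z i) g := by
  cases i
  · exact Commute.one_left g
  · exact h

theorem Commute.bitPow_right {z g : G} (h : Commute z g) (i : Bool) : Commute z (bitPow g i) :=
  (h.symm.bitPow_left i).symm

theorem bitPow_mul_self_eq {z g : G} {e : Bool} (h : g * g = bif e then z else 1) (i : Bool) :
    bitPow g i * g = bitPow z (i && e) * bitPow g (!i) := by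
  cases i <;> cases e <;> simp_all [bitPow]

theorem bitPow_mul_eq {z g h : G} {e : Bool} (hc : h * g = (bif e then z else 1) * (g * h))
    (i : Bool) : bitPow h i * g = bitPow z (i && e) * (g * bitPow h i) := by
  cases i <;> cases e <;> simp_all [bitPow]

theorem bitPow_mul_bitPow {z : G} (h : z * z = 1) (i j : Bool) :
    bitPow z i * bitPow z j = bitPow z (i ^^ j) := by
  cases i <;> cases j <;> simp_all [bitPow]

theorem conj_bitPow {g t : G} {e : Bool} (h : g * t * g⁻¹ = bif e then t⁻¹ else t) (i : Bool)
    (n : ℤ) : bitPow g i * t ^ n = t ^ (bif i && e then -n else n) * bitPow g i := by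
  cases i
  · simp [bitPow]
  · rw [bitPow_true, Bool.true_and, ← mul_inv_eq_iff_eq_mul, ← conj_zpow, h]
    cases e <;> simp

namespace QuadData.Frame

variable {D : QuadData} {t a b c z : G} (F : D.Frame t a b c z)

theorem bitPow_z_left_comm {g : G} (h : Commute z g) (i m : Bool) (y : G) :
    bitPow g i * (bitPow z m * y) = bitPow z m * (bitPow g i * y) :=
  ((h.bitPow_left m).bitPow_right i).symm.left_comm y

include F

theorem bitPow_z_mul (l m : Bool) (y : G) :
    bitPow z l * (bitPow z m * y) = bitPow z (l ^^ m) * y := by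
  rw [← mul_assoc, bitPow_mul_bitPow F.zz]

theorem val_mulA (q : QState) :
    QState.val a b c z (D.mulA q) = QState.val a b c z q * a := by
  obtain ⟨i, j, k, l⟩ := q
  have h2 : ∀ y, bitPow b j * (a * y) = bitPow z (j && D.ab) * (a * (bitPow b j * y)) := by
    intro y; rw [← mul_assoc, bitPow_mul_eq F.ba]; simp only [mul_assoc]
  have h3 : ∀ y, bitPow a i * (a * y) = bitPow z (i && D.qa) * (bitPow a (!i) * y) := by
    intro y; rw [← mul_assoc, bitPow_mul_self_eq F.aa, mul_assoc]
  simp only [QState.val, mulA, mul_assoc, bitPow_mul_eq F.ca, h2, h3, bitPow_z_left_comm F.za,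
    bitPow_z_left_comm F.zb, F.bitPow_z_mul]
  congr 2
  cases l <;> cases (i && D.qa) <;> cases (j && D.ab) <;> cases (k && D.ac) <;> rfl

theorem val_mulB (q : QState) :
    QState.val a b c z (D.mulB q) = QState.val a b c z q * b := by
  obtain ⟨i, j, k, l⟩ := q
  have h2 : ∀ y, bitPow b j * (b * y) = bitPow z (j && D.qb) * (bitPow b (!j) * y) := by
    intro y; rw [← mul_assoc, bitPow_mul_self_eq F.bb, mul_assoc]
  simp only [QState.val, mulB, mul_assoc, bitPow_mul_eq F.cb, h2, bitPow_z_left_comm F.za,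
    bitPow_z_left_comm F.zb, F.bitPow_z_mul]
  congr 2
  cases l <;> cases (j && D.qb) <;> cases (k && D.bc) <;> rfl

theorem val_mulC (q : QState) :
    QState.val a b c z (D.mulC q) = QState.val a b c z q * c := by
  obtain ⟨i, j, k, l⟩ := q
  simp only [QState.val, mulC, mul_assoc, bitPow_mul_self_eq F.cc, bitPow_z_left_comm F.za,
    bitPow_z_left_comm F.zb, F.bitPow_z_mul]

theorem val_mulZ (q : QState) (m : Bool) :
    QState.val a b c z (q.1, q.2.1, q.2.2.1, q.2.2.2 ^^ m) =
      QState.val a b c z q * bitPow z m := by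
  obtain ⟨i, j, k, l⟩ := q
  simp only [QState.val]
  rw [← bitPow_mul_bitPow F.zz]
  have h : Commute (bitPow z m) (bitPow a i * bitPow b j * bitPow c k) :=
    (((F.za.bitPow_left m).bitPow_right i).mul_right ((F.zb.bitPow_left m).bitPow_right j)).mul_right
      ((F.zc.bitPow_left m).bitPow_right k)
  simp only [mul_assoc] at h ⊢
  rw [h.eq]
  simp only [mul_assoc]

theorem val_mul (q g : QState) :
    QState.val a b c z (D.mul q g) = QState.val a b c z q * QState.val a b c z g := by
  obtain ⟨i, j, k, l⟩ := g
  have h : ∀ q m, QState.val a b c z (bif m then D.mulC q else q) =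
      QState.val a b c z q * bitPow c m := by
    rintro q (_ | _) <;> simp [F.val_mulC, bitPow]
  have h' : ∀ q m, QState.val a b c z (bif m then D.mulB q else q) =
      QState.val a b c z q * bitPow b m := by
    rintro q (_ | _) <;> simp [F.val_mulB, bitPow]
  have h'' : ∀ q m, QState.val a b c z (bif m then D.mulA q else q) =
      QState.val a b c z q * bitPow a m := by
    rintro q (_ | _) <;> simp [F.val_mulA, bitPow]
  simp only [mul, h, h', h'', F.val_mulZ]
  simp only [QState.val, mul_assoc]

omit F in
theorem val_one : QState.val a b c z QState.one = 1 := by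
  simp [QState.val, QState.one, bitPow]

theorem val_inv (q : QState) :
    QState.val a b c z (D.inv q) = (QState.val a b c z q)⁻¹ := by
  rw [eq_inv_iff_mul_eq_one, ← F.val_mul, ← val_one (a := a) (b := b) (c := c) (z := z)]
  congr 1
  obtain ⟨i, j, k, l⟩ := q
  cases i <;> cases j <;> cases k <;> cases l <;>
    simp [mul, inv, mulA, mulB, mulC, QState.one]
  all_goals
    cases D.qa <;> cases D.qb <;> cases D.qc <;> cases D.ab <;> cases D.ac <;> cases D.bc <;> rfl

theorem val_zpow (q : QState) (n : ℤ) :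
    QState.val a b c z q * t ^ n =
      t ^ (bif D.sgn q then -n else n) * QState.val a b c z q := by
  obtain ⟨i, j, k, l⟩ := q
  have ha : ∀ n : ℤ, bitPow a i * t ^ n = t ^ (bif i then -n else n) * bitPow a i := by
    simpa using conj_bitPow (e := true) (by simpa using F.at_inv) i
  have hz : ∀ n : ℤ, bitPow z l * t ^ n = t ^ n * bitPow z l :=
    fun n => ((F.zt.zpow_right n).bitPow_left l).eq
  simp only [QState.val]
  rw [mul_assoc, conj_bitPow F.ct, ← mul_assoc, mul_assoc _ (bitPow b j), conj_bitPow F.bt,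
    ← mul_assoc, mul_assoc _ (bitPow a i), ha, ← mul_assoc, hz]
  simp only [← mul_assoc]
  congr 5
  simp only [sgn]
  cases i <;> cases (j && D.xb) <;> cases (k && D.xc) <;> simp

theorem val_mulElt (r s : ℤ) (e g : Elt) :
    Elt.val t a b c z r s (D.mulElt e g) =
      Elt.val t a b c z r s e * Elt.val t a b c z r s g := by
  simp only [Elt.val, mulElt, F.val_mul]
  rw [mul_assoc, ← mul_assoc (QState.val a b c z e.1), F.val_zpow]
  simp only [← mul_assoc]
  rw [← zpow_add]
  congr 3
  cases D.sgn e.1 <;> simp only [cond_true, cond_false] <;> ring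

theorem val_invElt (r s : ℤ) (e : Elt) :
    Elt.val t a b c z r s (D.invElt e) = (Elt.val t a b c z r s e)⁻¹ := by
  simp only [Elt.val, invElt, F.val_inv]
  rw [mul_inv_rev, eq_comm, inv_mul_eq_iff_eq_mul, ← mul_assoc, F.val_zpow, mul_assoc,
    mul_inv_cancel, mul_one, ← zpow_neg]
  congr 1
  cases D.sgn e.1 with
  | false => simp only [cond_false]; ring
  | true => rfl

end QuadData.Frame

end

/-- The clause about `mask` carries the induction: the code of the current state is added to the
mask passed on, so no later state can share it. -/
theorem QuadData.trace_spec (D : QuadData) (code : Elt → ℕ) (L : List Elt) (s s' : Elt) (mask : ℕ)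
    (h : D.trace code L s mask = some s') :
    s' = L.foldl D.mulElt s ∧
    (∀ i < L.length, mask.testBit (code ((L.take i).foldl D.mulElt s)) = false) ∧
    ∀ i < L.length, ∀ j < L.length,
      code ((L.take i).foldl D.mulElt s) = code ((L.take j).foldl D.mulElt s) → i = j := by
  induction L generalizing s mask with
  | nil => simp only [trace, Option.some.injEq] at h; simp [h]
  | cons g L ih =>
    rw [trace, Elt.force_eq] at h
    cases hm : mask.testBit (code s) with
    | true => simp [hm] at h
    | false =>
      rw [hm, cond_false] at h
      obtain ⟨h1, h2, h3⟩ := ih _ _ h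
      simp only [Nat.testBit_or, Bool.or_eq_false_iff, Nat.testBit_two_pow,
        decide_eq_false_iff_not] at h2
      refine ⟨h1, ?_, ?_⟩
      · rintro (_ | i) hi
        · exact hm
        · exact (h2 i (by simpa using hi)).1
      · rintro (_ | i) hi (_ | j) hj hij
        · rfl
        · exact absurd hij (h2 j (by simpa using hj)).2
        · exact absurd hij.symm (h2 i (by simpa using hi)).2
        · rw [h3 i (by simpa using hi) j (by simpa using hj) hij]

/-! ### Lifting cycles from the quotient by ⟨t⟩ -/

section

variable {G : Type*} [Group G] {D : QuadData} {t a b c z : G} {p : ℕ} {r s : ℤ}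

theorem orderOf_zpow_of_not_dvd (hp : p.Prime) (ht : orderOf t = p) {n : ℤ} (hn : ¬ (p : ℤ) ∣ n) :
    orderOf (t ^ n) = p := by
  have := Fact.mk hp
  refine orderOf_eq_prime ?_ ?_
  · rw [← zpow_natCast, ← zpow_mul, mul_comm, zpow_mul, zpow_natCast, ← ht, pow_orderOf_eq_one,
      one_zpow]
  · rwa [ne_eq, ← orderOf_dvd_iff_zpow_eq_one, ht]

/-- Normal forms are distinct modulo the powers of `t`. -/
def QState.ValInjective (t a b c z : G) : Prop :=
  ∀ (n : ℤ) (q q' : QState), t ^ n * QState.val a b c z q = QState.val a b c z q' → q = q'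

theorem Elt.eq_of_zpow_mul_val (hinj : QState.ValInjective t a b c z) {m n : ℤ} {e e' : Elt}
    (h : t ^ m * Elt.val t a b c z r s e = t ^ n * Elt.val t a b c z r s e') : e.1 = e'.1 := by
  simp only [Elt.val] at h
  rw [← mul_assoc, ← mul_assoc, ← zpow_add, ← zpow_add, ← inv_mul_eq_iff_eq_mul, ← mul_assoc,
    ← zpow_neg, ← zpow_add] at h
  exact hinj _ _ _ h

theorem QuadData.Frame.val_start : Elt.val t a b c z r s (QState.one, 0, 0) = 1 := by
  simp [Elt.val, val_one]

theorem QuadData.Frame.exists_val_take_succ (F : D.Frame t a b c z) {L : List Elt} {S : Set G}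
    (hS : ∀ g ∈ L, Elt.val t a b c z r s g ∈ S ∨ (Elt.val t a b c z r s g)⁻¹ ∈ S) (e : Elt) {i : ℕ}
    (hi : i < L.length) :
    ∃ g, (g ∈ S ∨ g⁻¹ ∈ S) ∧ Elt.val t a b c z r s ((L.take (i + 1)).foldl D.mulElt e) =
      Elt.val t a b c z r s ((L.take i).foldl D.mulElt e) * g := by
  refine ⟨_, hS _ (List.getElem_mem hi), ?_⟩
  rw [List.take_succ_eq_append_getElem hi, List.foldl_append]
  simp [F.val_mulElt]

variable [Fintype G] [DecidableEq G]

/-- The factor group lemma. -/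
theorem QuadData.Frame.exists_isHamiltonianCycle_of_voltage (F : D.Frame t a b c z)
    (hp : p.Prime) (ht : orderOf t = p) (hcard : Nat.card G = 16 * p)
    (hinj : QState.ValInjective t a b c z) (S : Set G) (L : List Elt) (hlen : L.length = 16)
    (hS : ∀ g ∈ L, Elt.val t a b c z r s g ∈ S ∨ (Elt.val t a b c z r s g)⁻¹ ∈ S) {x : ℤ × ℤ}
    (hL : D.trace (fun e => e.1.code) L (QState.one, 0, 0) 0 = some (QState.one, x))
    (hx : ¬ (p : ℤ) ∣ x.1 * r + x.2 * s) :
    ∃ (v : G) (c : (SimpleGraph.mulCayley S).Walk v v), c.IsHamiltonianCycle := by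
  obtain ⟨hend, -, hcode⟩ := D.trace_spec _ _ _ _ _ hL
  have hpos := hp.pos
  set pre : ℕ → G := fun n =>
    Elt.val t a b c z r s ((L.take n).foldl D.mulElt (QState.one, 0, 0)) with hpre
  have hpre16 : pre 16 = t ^ (x.1 * r + x.2 * s) := by
    simp only [hpre]
    rw [← hlen, List.take_length, ← hend]
    simp [Elt.val, val_one]
  have hpre0 : pre 0 = 1 := by simpa [hpre] using val_start
  set w := t ^ (x.1 * r + x.2 * s) with hw
  have hord : orderOf w = p := orderOf_zpow_of_not_dvd hp ht hx
  have := hp.two_le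
  -- Traverse the word p times, each round shifted by the voltage `w`. The coset of ⟨t⟩ recovers the
  -- position in the word, and the power of `w` then recovers the round.
  refine exists_isHamiltonianCycle_mulCayley S (n := 16 * p) (by omega) hcard
    (fun n => w ^ (n / 16) * pre (n % 16)) ?_ ?_ ?_
  · intro i hi j hj hij
    have h1 : i % 16 = j % 16 := by
      apply hcode _ (by omega) _ (by omega)
      simp only [hw, hpre, ← zpow_natCast, ← zpow_mul] at hij
      rw [Elt.eq_of_zpow_mul_val hinj hij]
    simp only [h1] at hij
    have h2 : i / 16 = j / 16 :=
      pow_injOn_Iio_orderOf (by simp only [Set.mem_Iio]; omega) (by simp only [Set.mem_Iio]; omega)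
        (mul_right_cancel hij)
    omega
  · simp [hpre0, ← hord, pow_orderOf_eq_one]
  · intro i hi
    obtain ⟨g, hg, h⟩ := F.exists_val_take_succ (r := r) (s := s) hS (QState.one, 0, 0)
      (i := i % 16) (by omega)
    refine ⟨g, hg, ?_⟩
    have h' : pre (i % 16 + 1) = pre (i % 16) * g := h
    rw [mul_assoc, ← h']
    rcases Nat.lt_or_ge (i % 16) 15 with h15 | h15
    · rw [show (i + 1) / 16 = i / 16 by omega, show (i + 1) % 16 = i % 16 + 1 by omega]
    -- The end of one round, `pre 16 = w`, is the start of the next.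
    · rw [show (i + 1) / 16 = i / 16 + 1 by omega, show (i + 1) % 16 = 0 by omega,
        show i % 16 + 1 = 16 by omega, hpre0, hpre16, pow_succ, mul_one]

/-- A word that enumerates the whole group. -/
theorem QuadData.Frame.exists_isHamiltonianCycle_of_full (F : D.Frame t a b c z)
    (ht : orderOf t = p) (hp : p.Prime) (hcard : Nat.card G = 16 * p)
    (hinj : QState.ValInjective t a b c z) (S : Set G) (L : List Elt) (hlen : L.length = 16 * p)
    (hS : ∀ g ∈ L, Elt.val t a b c z r s g ∈ S ∨ (Elt.val t a b c z r s g)⁻¹ ∈ S) {x : ℤ × ℤ}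
    (hL : D.trace (fun e => e.1.code + 16 * ((e.2.1 * r + e.2.2 * s) % (p : ℤ)).toNat) L
      (QState.one, 0, 0) 0 = some (QState.one, x))
    (hx : (p : ℤ) ∣ x.1 * r + x.2 * s) :
    ∃ (v : G) (c : (SimpleGraph.mulCayley S).Walk v v), c.IsHamiltonianCycle := by
  obtain ⟨hend, -, hcode⟩ := D.trace_spec _ _ _ _ _ hL
  have := hp.two_le
  refine exists_isHamiltonianCycle_mulCayley S (n := 16 * p) (by omega) hcard
    (fun n => Elt.val t a b c z r s ((L.take n).foldl D.mulElt (QState.one, 0, 0))) ?_ ?_ ?_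
  · intro i hi j hj hij
    apply hcode _ (by omega) _ (by omega)
    have h1 := Elt.eq_of_zpow_mul_val hinj (m := 0) (n := 0) (by simpa using hij)
    simp only [Elt.val, h1] at hij
    rw [h1]
    have h2 := mul_right_cancel hij
    -- The code sees exponents only modulo p, which is all that equality in the group provides.
    rw [zpow_eq_zpow_iff_modEq, ht] at h2
    rw [h2]
  · rw [← hlen, List.take_length, ← hend]
    simp only [List.take_zero, List.foldl_nil, Elt.val, val_one, mul_one, zero_mul, add_zero,
      zpow_zero]
    rwa [← orderOf_dvd_iff_zpow_eq_one, ht]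
  · intro i hi
    exact F.exists_val_take_succ hS _ (by omega)

/-- If the generating set contains a power of `t`, one may traverse the cosets of the normal
subgroup one after the other. -/
theorem QuadData.Frame.exists_isHamiltonianCycle_of_normal (F : D.Frame t a b c z)
    (hp : p.Prime) (ht : orderOf t = p) (hcard : Nat.card G = 16 * p)
    (hinj : QState.ValInjective t a b c z) (S : Set G) (hr : ¬ (p : ℤ) ∣ r) (htS : t ^ r ∈ S)
    (L : List Elt) (hlen : L.length = 16)
    (hS : ∀ g ∈ L, t ^ r * Elt.val t a b c z r 0 g ∈ S ∨ (t ^ r * Elt.val t a b c z r 0 g)⁻¹ ∈ S)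
    {x : ℤ × ℤ}
    (hL : D.trace (fun e => e.1.code) L (QState.one, 0, 0) 0 = some (QState.one, x))
    (hx : x.1 = 0) :
    ∃ (v : G) (c : (SimpleGraph.mulCayley S).Walk v v), c.IsHamiltonianCycle := by
  obtain ⟨hend, -, hcode⟩ := D.trace_spec _ _ _ _ _ hL
  have hpos := hp.pos
  have := hp.two_le
  set pre : ℕ → G := fun n =>
    Elt.val t a b c z r 0 ((L.take n).foldl D.mulElt (QState.one, 0, 0)) with hpre
  have hpre16 : pre 16 = 1 := by
    simp only [hpre]
    rw [← hlen, List.take_length, ← hend]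
    simp [Elt.val, val_one, hx]
  have hpre0 : pre 0 = 1 := by simpa [hpre] using val_start
  set w := t ^ r with hw
  have hord : orderOf w = p := orderOf_zpow_of_not_dvd hp ht hr
  -- Walking inside a coset leaves the normal form unchanged, so a vertex determines which coset is
  -- being swept.
  have hmove : ∀ n m : ℕ, ∃ k : ℤ, pre n * w ^ m = t ^ k * pre n := by
    intro n m
    simp only [hpre, Elt.val]
    rw [hw, ← zpow_natCast, ← zpow_mul, mul_assoc, F.val_zpow, ← mul_assoc, ← zpow_add]
    exact ⟨_, by rw [← mul_assoc, ← zpow_add, sub_add_cancel]⟩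
  refine exists_isHamiltonianCycle_mulCayley S (n := 16 * p) (by omega) hcard
    (fun n => pre (n / p) * w ^ (n % p)) ?_ ?_ ?_
  · intro i hi j hj hij
    have hdiv : ∀ i < 16 * p, i / p < 16 := fun i hi => Nat.div_lt_of_lt_mul (by linarith)
    have h1 : i / p = j / p := by
      apply hcode _ (by rw [hlen]; exact hdiv i hi) _ (by rw [hlen]; exact hdiv j hj)
      obtain ⟨k, hk⟩ := hmove (i / p) (i % p)
      obtain ⟨k', hk'⟩ := hmove (j / p) (j % p)
      simp only [hk, hk'] at hij
      rw [Elt.eq_of_zpow_mul_val hinj hij]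
    simp only [h1] at hij
    have h2 : i % p = j % p :=
      pow_injOn_Iio_orderOf (by simpa [hord] using Nat.mod_lt _ hpos)
        (by simpa [hord] using Nat.mod_lt _ hpos) (mul_left_cancel hij)
    rw [← Nat.div_add_mod i p, h1, h2, Nat.div_add_mod]
  · simp [hpre0, hpos.ne', hpre16]
  · intro i hi
    have hi' : i / p < 16 := Nat.div_lt_of_lt_mul (by linarith)
    have hmod := Nat.mod_lt i hpos
    rcases Nat.lt_or_ge (i % p + 1) p with hlt | hge
    · refine ⟨w, Or.inl htS, ?_⟩
      have h1 : (i + 1) / p = i / p := by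
        have h3 := Nat.div_add_mod i p
        rw [show i + 1 = p * (i / p) + (i % p + 1) by omega, Nat.mul_add_div hpos,
          Nat.div_eq_of_lt hlt, add_zero]
      have h2 : (i + 1) % p = i % p + 1 := by
        rw [Nat.add_mod, Nat.mod_eq_of_lt (a := 1) (by omega), Nat.mod_eq_of_lt hlt]
      rw [h1, h2, pow_succ, mul_assoc]
    · have h3 : i + 1 = p * (i / p + 1) := by
        have := Nat.div_add_mod i p
        rw [Nat.mul_add]; omega
      obtain ⟨g, hg, h⟩ : ∃ g, (w * g ∈ S ∨ (w * g)⁻¹ ∈ S) ∧ pre (i / p + 1) = pre (i / p) * g := by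
        refine ⟨_, hS _ (List.getElem_mem (n := i / p) (by omega)), ?_⟩
        simp only [hpre]
        rw [List.take_succ_eq_append_getElem (by omega), List.foldl_append]
        simp [F.val_mulElt]
      refine ⟨w * g, hg, ?_⟩
      rw [h3, Nat.mul_div_cancel_left _ hpos, Nat.mul_mod_right, h, pow_zero, mul_one]
      -- The p - 1 steps already made and the factor `w` of `w * g` combine to `w ^ p = 1`.
      rw [show i % p = p - 1 by omega, ← mul_assoc, mul_assoc _ _ w, ← pow_succ,
        Nat.sub_add_cancel hpos, ← hord, pow_orderOf_eq_one, mul_one]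

end

/-! ### From checked words to Hamiltonian cycles -/

section

variable {G : Type*} [Group G] {D : QuadData} {t a b c z : G} {p : ℕ} {r s : ℤ}

theorem digitList_length (k n : ℕ) : (digitList k n).length = k := by
  induction k generalizing n with
  | zero => rfl
  | succ k ih => simp [digitList, ih]

theorem QuadData.trace_of_voltage {f : ℕ → Elt} {w : ℕ} {x : ℤ × ℤ} (h : D.voltage f w = some x) :
    D.trace (fun e => e.1.code) ((digitList 16 w).map f) (QState.one, 0, 0) 0 =
      some (QState.one, x) := by
  unfold voltage at h
  split at h
  · rename_i h'
    rw [Option.some.injEq] at h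
    rw [h', h]
    rfl
  · simp at h

theorem QuadData.Frame.letter_mem (F : D.Frame t a b c z) {S : Set G} {g₁ g₂ g₃ g₄ : Elt}
    (h₁ : Elt.val t a b c z r s g₁ ∈ S) (h₂ : Elt.val t a b c z r s g₂ ∈ S)
    (h₃ : Elt.val t a b c z r s g₃ ∈ S) (h₄ : Elt.val t a b c z r s g₄ ∈ S) (n : ℕ) :
    Elt.val t a b c z r s (D.letter g₁ g₂ g₃ g₄ n) ∈ S ∨
      (Elt.val t a b c z r s (D.letter g₁ g₂ g₃ g₄ n))⁻¹ ∈ S := by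
  unfold letter
  split <;> (try rw [F.val_invElt, inv_inv]) <;> tauto

theorem QState.val_a : QState.val a b c z QState.a = a := by simp [QState.val, QState.a, bitPow]

theorem QState.val_b : QState.val a b c z QState.b = b := by simp [QState.val, QState.b, bitPow]

theorem QState.val_c : QState.val a b c z QState.c = c := by simp [QState.val, QState.c, bitPow]

theorem QuadData.Frame.letterThree_mem (F : D.Frame t a b c z) {S : Set G} (ha : a ∈ S)
    (hb : t ^ r * b ∈ S) (hc : t ^ s * c ∈ S) (n : ℕ) :
    Elt.val t a b c z r s (D.letterThree n) ∈ S ∨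
      (Elt.val t a b c z r s (D.letterThree n))⁻¹ ∈ S := by
  apply F.letter_mem <;> simpa [Elt.val, QState.val_a, QState.val_b, QState.val_c]

theorem QuadData.Frame.zpow (F : D.Frame t a b c z) (m : ℤ) : D.Frame (t ^ m) a b c z where
  zt := F.zt.zpow_right m
  za := F.za
  zb := F.zb
  zc := F.zc
  zz := F.zz
  aa := F.aa
  bb := F.bb
  cc := F.cc
  ba := F.ba
  ca := F.ca
  cb := F.cb
  at_inv := by rw [← conj_zpow, F.at_inv, inv_zpow]
  bt := by rw [← conj_zpow, F.bt]; cases D.xb <;> simp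
  ct := by rw [← conj_zpow, F.ct]; cases D.xc <;> simp

theorem QState.ValInjective.zpow (h : QState.ValInjective t a b c z) (m : ℤ) :
    QState.ValInjective (t ^ m) a b c z := by
  intro n q q' hq
  rw [← zpow_mul] at hq
  exact h _ _ _ hq

variable [Fintype G] [DecidableEq G]

theorem QuadData.Frame.exists_isHamiltonianCycle_of_voltage_some (F : D.Frame t a b c z)
    (hp : p.Prime) (ht : orderOf t = p) (hcard : Nat.card G = 16 * p)
    (hinj : QState.ValInjective t a b c z) (S : Set G) {f : ℕ → Elt} {w : ℕ} {x : ℤ × ℤ}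
    (hS : ∀ n, Elt.val t a b c z r s (f n) ∈ S ∨ (Elt.val t a b c z r s (f n))⁻¹ ∈ S)
    (hw : D.voltage f w = some x) (hx : ¬ (p : ℤ) ∣ x.1 * r + x.2 * s) :
    ∃ (v : G) (c : (SimpleGraph.mulCayley S).Walk v v), c.IsHamiltonianCycle := by
  refine F.exists_isHamiltonianCycle_of_voltage hp ht hcard hinj S _ (by simp [digitList_length])
    ?_ (D.trace_of_voltage hw) hx
  intro g hg
  obtain ⟨n, -, rfl⟩ := List.mem_map.1 hg
  exact hS n

/-- Replacing `t` by the generator `t ^ m` turns the exponents `r`, `s` into the constants `u`, `v`,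
so one computation covers every pair in that ratio. -/
theorem QuadData.Frame.exists_isHamiltonianCycle_of_checkFull {u v m : ℤ} {n w : ℕ}
    (F : D.Frame t a b c z) (hp : p.Prime) (ht : orderOf t = p) (hcard : Nat.card G = 16 * p)
    (hinj : QState.ValInjective t a b c z) (S : Set G) (ha : a ∈ S) (hb : t ^ r * b ∈ S)
    (hc : t ^ s * c ∈ S) (hm : ¬ (p : ℤ) ∣ m) (hr : (p : ℤ) ∣ r - m * u) (hs : (p : ℤ) ∣ s - m * v)
    (hn : n = 4 * p) (h : D.checkFull p u v n w = true) :
    ∃ (v : G) (c : (SimpleGraph.mulCayley S).Walk v v), c.IsHamiltonianCycle := by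
  have hpow : ∀ {r u : ℤ}, (p : ℤ) ∣ r - m * u → t ^ r = (t ^ m) ^ u := by
    intro r u hr
    rw [← zpow_mul, zpow_eq_zpow_iff_modEq, ht]
    exact (Int.modEq_iff_dvd.2 hr).symm
  rw [hpow hr] at hb
  rw [hpow hs] at hc
  unfold checkFull at h
  split at h
  · rename_i hx
    refine (F.zpow m).exists_isHamiltonianCycle_of_full (orderOf_zpow_of_not_dvd hp ht hm) hp hcard
      (hinj.zpow m) S _ ?_ ?_ hx (of_decide_eq_true h)
    · simp [digitList_length, hn]; ring
    · intro g hg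
      obtain ⟨l, hl, hg⟩ := List.mem_flatten.1 hg
      rw [List.eq_of_mem_replicate hl] at hg
      obtain ⟨k, -, rfl⟩ := List.mem_map.1 hg
      exact (F.zpow m).letterThree_mem ha hb hc k
  · exact absurd h (by simp)

/-- The case of three generators, not all in a complement of the normal subgroup. -/
theorem QuadData.Frame.exists_isHamiltonianCycle_of_three (F : D.Frame t a b c z)
    (hp : p.Prime) (hodd : Odd p) (ht : orderOf t = p) (hcard : Nat.card G = 16 * p)
    (hinj : QState.ValInjective t a b c z) (hD : (D.ab || D.ac || D.bc) = true) (S : Set G)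
    (ha : a ∈ S) (hb : t ^ r * b ∈ S) (hc : t ^ s * c ∈ S)
    (hrs : ¬ ((p : ℤ) ∣ r ∧ (p : ℤ) ∣ s)) :
    ∃ (v : G) (c : (SimpleGraph.mulCayley S).Walk v v), c.IsHamiltonianCycle := by
  by_contra hno
  have hpZ : Prime (p : ℤ) := Nat.prime_iff_prime_int.1 hp
  have h2 : ∀ k : ℕ, ¬ (p : ℤ) ∣ 2 ^ k := by
    intro k hk
    have h := hpZ.dvd_of_dvd_pow hk
    have : p ∣ 2 := by exact_mod_cast h
    rw [(Nat.prime_dvd_prime_iff_eq hp Nat.prime_two).1 this] at hodd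
    exact absurd hodd (by decide)
  -- Without a Hamiltonian cycle, every word with a voltage imposes a linear congruence on `r` and
  -- `s`.
  have hvol : ∀ w x, D.voltage D.letterThree w = some x → (p : ℤ) ∣ x.1 * r + x.2 * s := by
    intro w x hw
    by_contra hx
    exact hno (F.exists_isHamiltonianCycle_of_voltage_some hp ht hcard hinj S
      (F.letterThree_mem ha hb hc) hw hx)
  obtain ⟨qa, qb, qc, ab, ac, bc, xb, xc⟩ := D
  cases hex : QuadData.exceptional ⟨qa, qb, qc, ab, ac, bc, xb, xc⟩ with
  | false =>
    have h := checkThree_eq_true qa qb qc ab ac bc xb xc hD hex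
    simp only [checkThree, List.any_eq_true, List.mem_filterMap, decide_eq_true_eq] at h
    obtain ⟨x, ⟨w, -, hw⟩, y, ⟨w', -, hw'⟩, h⟩ := h
    have hx := hvol _ _ hw
    have hy := hvol _ _ hw'
    -- Cramer's rule for the two congruences.
    have h1 : (p : ℤ) ∣ (x.1 * y.2 - x.2 * y.1) * r := by
      have := (hx.mul_right y.2).sub (hy.mul_right x.2)
      exact this.trans (dvd_of_eq (by ring))
    have h3 : (p : ℤ) ∣ (x.1 * y.2 - x.2 * y.1) * s := by
      have := (hy.mul_right x.1).sub (hx.mul_right y.1)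
      exact this.trans (dvd_of_eq (by ring))
    have h4 : ¬ (p : ℤ) ∣ x.1 * y.2 - x.2 * y.1 := fun h' => h2 10 (h'.trans (by simpa using h))
    exact hrs ⟨(hpZ.dvd_or_dvd h1).resolve_left h4, (hpZ.dvd_or_dvd h3).resolve_left h4⟩
  | true =>
    have hcancel : ∀ (k : ℕ) {x : ℤ}, (p : ℤ) ∣ 2 ^ k * x → (p : ℤ) ∣ x :=
      fun k x h => (hpZ.dvd_or_dvd h).resolve_left (h2 k)
    have hprime : ∀ {q : ℕ} {x : ℤ}, q.Prime → (p : ℤ) ∣ q * x → ¬ (p : ℤ) ∣ x → p = q := by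
      intro q x hq h hx
      exact (Nat.prime_dvd_prime_iff_eq hp hq).1
        (by exact_mod_cast (hpZ.dvd_or_dvd h).resolve_right hx)
    have hfull := fun {u v m : ℤ} {n w : ℕ} =>
      F.exists_isHamiltonianCycle_of_checkFull (u := u) (v := v) (m := m) (n := n) (w := w)
        hp ht hcard hinj S ha hb hc
    simp only [exceptional, Bool.and_eq_true, Bool.or_eq_true, Bool.not_eq_true'] at hex
    obtain ⟨⟨⟨⟨⟨rfl, rfl⟩, rfl⟩, rfl⟩, rfl⟩, hex⟩ := hex
    rcases hex with ((⟨⟨rfl, rfl⟩, rfl⟩ | ⟨⟨rfl, rfl⟩, rfl⟩) | ⟨⟨rfl, rfl⟩, rfl⟩) |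
      ⟨⟨rfl, rfl⟩, rfl⟩
    · have h₁ := hvol _ _ voltage_ab.1
      have h₂ := hvol _ _ voltage_ab.2
      simp only at h₁ h₂
      have h₃ : (p : ℤ) ∣ 3 * r + s := hcancel 1 ((h₂.neg_right).trans (dvd_of_eq (by ring)))
      have h₄ : (p : ℤ) ∣ (7 : ℕ) * r :=
        hcancel 1 ((h₁.sub h₂).trans (dvd_of_eq (by push_cast; ring)))
      have hr : ¬ (p : ℤ) ∣ r := fun h => hrs ⟨h, (h₃.sub (h.mul_left 3)).trans (dvd_of_eq (by ring))⟩
      obtain rfl := hprime (by norm_num) h₄ hr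
      push_cast at h₃ hr
      -- Modulo 7, s ≡ -3r ≡ 4r, so (r, s) ≡ 4r · (2, 1).
      exact hno (hfull (m := 4 * r) (by push_cast; omega) (by push_cast; omega)
        (by push_cast; omega) rfl checkFull_ab)
    · have h₁ := hvol _ _ voltage_ac.1
      have h₂ := hvol _ _ voltage_ac.2
      simp only at h₁ h₂
      have h₃ : (p : ℤ) ∣ r + 3 * s := hcancel 1 ((h₁.neg_right).trans (dvd_of_eq (by ring)))
      have h₄ : (p : ℤ) ∣ (7 : ℕ) * s :=
        hcancel 1 ((h₂.sub h₁).trans (dvd_of_eq (by push_cast; ring)))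
      have hs : ¬ (p : ℤ) ∣ s := fun h => hrs ⟨(h₃.sub (h.mul_left 3)).trans (dvd_of_eq (by ring)), h⟩
      obtain rfl := hprime (by norm_num) h₄ hs
      push_cast at h₃ hs
      -- Modulo 7, r ≡ -3s ≡ 4s, so (r, s) ≡ 4s · (1, 2).
      exact hno (hfull (m := 4 * s) (by push_cast; omega) (by push_cast; omega)
        (by push_cast; omega) rfl checkFull_ac)
    · have h₁ := hvol _ _ voltage_bc.1
      have h₂ := hvol _ _ voltage_bc.2
      simp only at h₁ h₂
      have h₃ : (p : ℤ) ∣ r + s := hcancel 1 ((h₁.add h₂).trans (dvd_of_eq (by ring)))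
      have h₄ : (p : ℤ) ∣ (7 : ℕ) * r :=
        hcancel 1 ((h₁.add (h₃.mul_left 6)).trans (dvd_of_eq (by push_cast; ring)))
      have hr : ¬ (p : ℤ) ∣ r := fun h => hrs ⟨h, (h₃.sub h).trans (dvd_of_eq (by ring))⟩
      obtain rfl := hprime (by norm_num) h₄ hr
      push_cast at h₃ hr
      exact hno (hfull (m := r) (by push_cast; omega) (by push_cast; omega)
        (by push_cast; omega) rfl checkFull_bc)
    · have h₁ := hvol _ _ voltage_all.1
      have h₂ := hvol _ _ voltage_all.2
      simp only at h₁ h₂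
      have h₃ : (p : ℤ) ∣ r + s := hcancel 2 ((h₂).trans (dvd_of_eq (by ring)))
      have h₄ : (p : ℤ) ∣ (3 : ℕ) * r :=
        hcancel 2 ((h₁.add h₂).trans (dvd_of_eq (by push_cast; ring)))
      have hr : ¬ (p : ℤ) ∣ r := fun h => hrs ⟨h, (h₃.sub h).trans (dvd_of_eq (by ring))⟩
      obtain rfl := hprime (by norm_num) h₄ hr
      push_cast at h₃ hr
      -- Modulo 3, s ≡ -r ≡ 2r.
      exact hno (hfull (m := r) (by push_cast; omega) (by push_cast; omega)
        (by push_cast; omega) rfl checkFull_all)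

/-- The case of three generators of a complement together with a fourth element. -/
theorem QuadData.Frame.exists_isHamiltonianCycle_of_four (F : D.Frame t a b c z)
    (hp : p.Prime) (hodd : Odd p) (ht : orderOf t = p) (hcard : Nat.card G = 16 * p)
    (hinj : QState.ValInjective t a b c z) (S : Set G)
    (ha : a ∈ S) (hb : b ∈ S) (hc : c ∈ S) (hr : ¬ (p : ℤ) ∣ r) {d : QState}
    (hd : t ^ r * QState.val a b c z d ∈ S) (hcheck : D.checkFour d = true) :
    ∃ (v : G) (c : (SimpleGraph.mulCayley S).Walk v v), c.IsHamiltonianCycle := by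
  have hpZ : Prime (p : ℤ) := Nat.prime_iff_prime_int.1 hp
  simp only [checkFour, List.any_eq_true] at hcheck
  obtain ⟨w, -, hw⟩ := hcheck
  split at hw
  · rename_i x hx
    refine F.exists_isHamiltonianCycle_of_voltage_some (r := r) (s := 0) hp ht hcard hinj S ?_ hx ?_
    · intro n
      apply F.letter_mem <;> simpa [Elt.val, QState.val_a, QState.val_b, QState.val_c]
    · intro h
      rw [mul_zero, add_zero] at h
      have h' := ((hpZ.dvd_or_dvd h).resolve_right hr).trans (of_decide_eq_true hw)
      have : p ∣ 2 ^ 10 := by exact_mod_cast h'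
      rw [(Nat.prime_dvd_prime_iff_eq hp Nat.prime_two).1 (hp.dvd_of_dvd_pow this)] at hodd
      exact absurd hodd (by decide)
  · simp at hw

/-- The case of three generators of a complement together with an element of the normal
subgroup. -/
theorem QuadData.Frame.exists_isHamiltonianCycle_of_mem_normal (F : D.Frame t a b c z)
    (hp : p.Prime) (ht : orderOf t = p) (hcard : Nat.card G = 16 * p)
    (hinj : QState.ValInjective t a b c z) (hD : (D.ab || D.ac || D.bc) = true) (S : Set G)
    (ha : a ∈ S) (hb : b ∈ S) (hc : c ∈ S) (hr : ¬ (p : ℤ) ∣ r) (hd : t ^ r ∈ S) :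
    ∃ (v : G) (c : (SimpleGraph.mulCayley S).Walk v v), c.IsHamiltonianCycle := by
  have hcheck : D.checkOne = true := by
    obtain ⟨qa, qb, qc, ab, ac, bc, xb, xc⟩ := D
    exact checkOne_eq_true _ _ _ _ _ _ _ _ hD
  simp only [checkOne, List.any_eq_true] at hcheck
  obtain ⟨w, -, hw⟩ := hcheck
  split at hw
  · rename_i x hx
    refine F.exists_isHamiltonianCycle_of_normal hp ht hcard hinj S hr hd _
      (by simp [digitList_length]) ?_ (D.trace_of_voltage hx) (of_decide_eq_true hw)
    intro g hg
    obtain ⟨n, -, rfl⟩ := List.mem_map.1 hg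
    left
    unfold letterOne
    split <;> simpa [Elt.val, QState.val_a, QState.val_b, QState.val_c]
  · simp at hw

end

/-! ### Linear algebra in the abelianization -/

/-- The elementary abelian group of order eight. -/
abbrev Elem8 := Multiplicative (ZMod 2 × ZMod 2 × ZMod 2)

/-- Independence of three elements of an elementary abelian 2-group. -/
def Indep3 (x y w : Elem8) : Prop :=
  ∀ i j k : Bool, bitPow x i * bitPow y j * bitPow w k = 1 → i = false ∧ j = false ∧ k = false

instance (x y w : Elem8) : Decidable (Indep3 x y w) :=
  inferInstanceAs (Decidable (∀ _ _ _, _))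

theorem Elem8.mul_self : ∀ x : Elem8, x * x = 1 := by decide

set_option synthInstance.maxSize 2000 in
set_option synthInstance.maxHeartbeats 400000 in
theorem indep3_of_notMem : ∀ x y w : Elem8, x ≠ 1 → (y ≠ 1 ∧ y ≠ x) →
    (w ≠ 1 ∧ w ≠ x ∧ w ≠ y ∧ w ≠ x * y) → Indep3 x y w := by
  decide +kernel

theorem Indep3.replace_second : ∀ (i k : Bool) (x y w : Elem8), Indep3 x y w →
    Indep3 x (bitPow x i * y * bitPow w k) w := by
  decide +kernel

theorem Indep3.replace_third : ∀ (i j : Bool) (x y w : Elem8), Indep3 x y w →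
    Indep3 x y (bitPow x i * bitPow y j * w) := by
  decide +kernel

theorem Indep3.swap_first_second : ∀ x y w : Elem8, Indep3 x y w → Indep3 y x w := by
  decide +kernel

theorem Indep3.swap_first_third : ∀ x y w : Elem8, Indep3 x y w → Indep3 w y x := by
  decide +kernel

theorem Indep3.injective {x y w : Elem8} (h : Indep3 x y w) {i j k i' j' k' : Bool}
    (h' : bitPow x i * bitPow y j * bitPow w k = bitPow x i' * bitPow y j' * bitPow w k') :
    i = i' ∧ j = j' ∧ k = k' := by
  have := h (i ^^ i') (j ^^ j') (k ^^ k') (by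
    rw [← bitPow_mul_bitPow (Elem8.mul_self x), ← bitPow_mul_bitPow (Elem8.mul_self y),
      ← bitPow_mul_bitPow (Elem8.mul_self w)]
    calc _ = (bitPow x i * bitPow y j * bitPow w k) * (bitPow x i' * bitPow y j' * bitPow w k') := by
          ac_rfl
      _ = 1 := by rw [← h', Elem8.mul_self])
  simpa using this

/-- Two vectors do not span a three-dimensional space over the field with two elements, so a nonzero
functional kills both. -/
theorem exists_character : ∀ x y : Elem8, ∃ u : ZMod 2 × ZMod 2 × ZMod 2,
    (u ≠ 0 ∧ u.1 * x.toAdd.1 + u.2.1 * x.toAdd.2.1 + u.2.2 * x.toAdd.2.2 = 0) ∧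
      u.1 * y.toAdd.1 + u.2.1 * y.toAdd.2.1 + u.2.2 * y.toAdd.2.2 = 0 := by
  decide +kernel

theorem exists_character_ne : ∀ u : ZMod 2 × ZMod 2 × ZMod 2, u ≠ 0 → ∃ w : Elem8,
    u.1 * w.toAdd.1 + u.2.1 * w.toAdd.2.1 + u.2.2 * w.toAdd.2.2 ≠ 0 := by
  decide +kernel

section

variable {G : Type*} [Group G]

/-- A generating set is not mapped into the subgroup generated by two elements. -/
theorem exists_mem_notMem_span {S : Set G} (hS : Subgroup.closure S = ⊤) {f : G →* Elem8}
    (hf : Function.Surjective f) (x y : Elem8) :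
    ∃ s ∈ S, f s ≠ 1 ∧ f s ≠ x ∧ f s ≠ y ∧ f s ≠ x * y := by
  obtain ⟨u, ⟨hu, hx⟩, hy⟩ := exists_character x y
  obtain ⟨w, hw⟩ := exists_character_ne u hu
  obtain ⟨g, rfl⟩ := hf w
  -- The kernel of the functional `u` is a proper subgroup containing `x` and `y`; a generating set
  -- cannot be mapped into it.
  let H : Subgroup Elem8 :=
    { carrier := {w | u.1 * w.toAdd.1 + u.2.1 * w.toAdd.2.1 + u.2.2 * w.toAdd.2.2 = 0}
      mul_mem' := by
        intro v w hv hw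
        simp only [Set.mem_ofPred_eq, toAdd_mul, Prod.fst_add, Prod.snd_add] at *
        linear_combination hv + hw
      one_mem' := by simp
      inv_mem' := by
        intro v hv
        simp only [Set.mem_ofPred_eq, toAdd_inv, Prod.fst_neg, Prod.snd_neg] at *
        linear_combination -hv }
  have hxH : x ∈ H := hx
  have hyH : y ∈ H := hy
  have hgH : f g ∉ H := hw
  by_contra! hno
  have hle : S ⊆ H.comap f := by
    intro s hs
    change f s ∈ H
    by_cases h1 : f s = 1
    · rw [h1]; exact H.one_mem
    by_cases h2 : f s = x
    · rwa [h2]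
    by_cases h3 : f s = y
    · rwa [h3]
    rw [hno s hs h1 h2 h3]
    exact H.mul_mem hxH hyH
  have := (Subgroup.closure_le _).2 hle
  rw [hS] at this
  exact hgH (this (Subgroup.mem_top g))

/-! ### Action on the normal subgroup and structure of its complements -/

/-- A group of order `16 * p` with a normal subgroup generated by an element `t` of order `p` and
whose abelianization is `f`. -/
structure NormalSetting (p : ℕ) (t : G) (f : G →* Elem8) : Prop where
  prime : p.Prime
  odd : Odd p
  card : Nat.card G = 16 * p
  orderOf_t : orderOf t = p
  normal : (Subgroup.zpowers t).Normal
  surj : Function.Surjective f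
  mem_commutator : ∀ g : G, f g = 1 ↔ g ∈ commutator G

namespace NormalSetting

variable {p : ℕ} {t : G} {f : G →* Elem8} (h : NormalSetting p t f)

include h

theorem f_t : f t = 1 := by
  have h1 : f t ^ p = 1 := by rw [← map_pow, ← h.orderOf_t, pow_orderOf_eq_one, map_one]
  obtain ⟨k, hk⟩ := h.odd
  rwa [hk, pow_succ, pow_mul, pow_two, Elem8.mul_self, one_pow, one_mul] at h1

theorem exists_conj_eq_zpow (g : G) : ∃ k : ℤ, g * t * g⁻¹ = t ^ k := by
  obtain ⟨k, hk⟩ := h.normal.conj_mem t (Subgroup.mem_zpowers t) g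
  exact ⟨k, hk.symm⟩

/-- Conjugations act on ⟨t⟩ by power maps, which commute with each other, so commutators act
trivially. -/
theorem commute_of_f_eq_one {g : G} (hg : f g = 1) : Commute g t := by
  rw [h.mem_commutator] at hg
  have hcomm : ∀ a b : G, a * b * t * (a * b)⁻¹ = b * a * t * (b * a)⁻¹ := by
    intro a b
    have h1 : ∀ a b : G, a * b * t * (a * b)⁻¹ = a * (b * t * b⁻¹) * a⁻¹ := by intros; group
    obtain ⟨k, hk⟩ := h.exists_conj_eq_zpow a
    obtain ⟨l, hl⟩ := h.exists_conj_eq_zpow b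
    rw [h1, h1, hk, hl, ← conj_zpow, ← conj_zpow, hk, hl, ← zpow_mul, ← zpow_mul, mul_comm]
  have hle : commutator G ≤ Subgroup.centralizer {t} := by
    rw [commutator_def, Subgroup.commutator_le]
    intro a _ b _
    rw [Subgroup.mem_centralizer_singleton_iff, commutatorElement_def]
    have := hcomm a⁻¹ b⁻¹
    have h2 : a * b * (a⁻¹ * b⁻¹ * t * (a⁻¹ * b⁻¹)⁻¹) * (a * b)⁻¹ =
        a * b * (b⁻¹ * a⁻¹ * t * (b⁻¹ * a⁻¹)⁻¹) * (a * b)⁻¹ := by rw [this]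
    have h3 : a * b * (b⁻¹ * a⁻¹ * t * (b⁻¹ * a⁻¹)⁻¹) * (a * b)⁻¹ = t := by group
    rw [h3] at h2
    have h4 : a * b * (a⁻¹ * b⁻¹ * t * (a⁻¹ * b⁻¹)⁻¹) * (a * b)⁻¹ =
      (a * b * a⁻¹ * b⁻¹) * t * (a * b * a⁻¹ * b⁻¹)⁻¹ := by group
    rw [h4, mul_inv_eq_iff_eq_mul] at h2
    exact h2
  have := hle hg
  rw [Subgroup.mem_centralizer_singleton_iff] at this
  exact this

/-- The square of `g` lies in the commutator subgroup and so centralizes `t`; if `g` acts by the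
exponent k, then k² ≡ 1 modulo the prime p. -/
theorem conj_t (g : G) : g * t * g⁻¹ = t ∨ g * t * g⁻¹ = t⁻¹ := by
  obtain ⟨k, hk⟩ := h.exists_conj_eq_zpow g
  have h1 : t ^ (k * k) = t ^ (1 : ℤ) := by
    rw [zpow_mul, ← hk, conj_zpow, ← hk, zpow_one]
    have := (h.commute_of_f_eq_one (g := g * g) (by rw [map_mul, Elem8.mul_self])).eq
    rw [show g * (g * t * g⁻¹) * g⁻¹ = g * g * t * (g * g)⁻¹ by group, this, mul_inv_cancel_right]
  rw [zpow_eq_zpow_iff_modEq, h.orderOf_t] at h1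
  have h2 : (p : ℤ) ∣ (k - 1) * (k + 1) := by
    have := h1.symm.dvd
    rwa [show k * k - 1 = (k - 1) * (k + 1) by ring] at this
  rw [hk]
  rcases (Nat.prime_iff_prime_int.1 h.prime).dvd_or_dvd h2 with h3 | h3
  · left
    nth_rw 2 [← zpow_one t]
    rw [zpow_eq_zpow_iff_modEq, h.orderOf_t]
    exact (Int.modEq_iff_dvd.2 h3).symm
  · right
    rw [← zpow_neg_one, zpow_eq_zpow_iff_modEq, h.orderOf_t]
    exact (Int.modEq_iff_dvd.2 (by rwa [sub_neg_eq_add])).symm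

end NormalSetting

end

theorem QuadData.mul_comm_of_commute : ∀ (qa qb qc xb xc : Bool) (q g : QState),
    QuadData.mul ⟨qa, qb, qc, false, false, false, xb, xc⟩ q g =
      QuadData.mul ⟨qa, qb, qc, false, false, false, xb, xc⟩ g q := by
  decide +kernel

namespace NormalSetting

variable {G : Type*} [Group G] {p : ℕ} {t : G} {f : G →* Elem8} (h : NormalSetting p t f)

include h

theorem coprime : Nat.Coprime p 16 := by
  have : Nat.Coprime p 2 := Nat.coprime_two_right.2 h.odd
  simpa using this.pow_right 4

theorem isComplement' {Q : Subgroup G} (hQ : Nat.card Q = 16) :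
    (Subgroup.zpowers t).IsComplement' Q := by
  have : Finite G := Nat.finite_of_card_ne_zero (by rw [h.card]; have := h.prime.pos; omega)
  apply Subgroup.isComplement'_of_coprime
  · rw [Nat.card_zpowers, h.orderOf_t, hQ, h.card, mul_comm]
  · rw [Nat.card_zpowers, h.orderOf_t, hQ]; exact h.coprime

theorem exists_eq_zpow_mul {Q : Subgroup G} (hQ : Nat.card Q = 16) (g : G) :
    ∃ n : ℤ, ∃ q ∈ Q, g = t ^ n * q := by
  obtain ⟨⟨⟨_, n, rfl⟩, q, hq⟩, hg⟩ := (h.isComplement' hQ).2 g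
  exact ⟨n, q, hq, hg.symm⟩

theorem zpow_eq_one {Q : Subgroup G} (hQ : Nat.card Q = 16) {n : ℤ} (hn : t ^ n ∈ Q) :
    t ^ n = 1 := by
  have := (h.isComplement' hQ).disjoint
  rw [Subgroup.disjoint_def] at this
  exact this (Subgroup.zpow_mem_zpowers t n) hn

theorem f_zpow_mul (n : ℤ) (g : G) : f (t ^ n * g) = f g := by
  rw [map_mul, map_zpow, h.f_t, one_zpow, one_mul]

/-- A complement of the normal subgroup contains a unique involution of the commutator subgroup. -/
theorem exists_involution {Q : Subgroup G} (hQ : Nat.card Q = 16) :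
    ∃ z ∈ Q, z ≠ 1 ∧ f z = 1 ∧ ∀ q ∈ Q, f q = 1 → q = 1 ∨ q = z := by
  have hsurj : Function.Surjective (f.comp Q.subtype) := by
    intro v
    obtain ⟨g, rfl⟩ := h.surj v
    obtain ⟨n, q, hq, rfl⟩ := h.exists_eq_zpow_mul hQ g
    exact ⟨⟨q, hq⟩, (h.f_zpow_mul n q).symm⟩
  -- Since `f` kills `t`, its restriction to `Q` is still onto the group of order 8.
  have hcard : Nat.card (f.comp Q.subtype).ker = 2 := by
    have h1 := Subgroup.card_mul_index (f.comp Q.subtype).ker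
    rw [Subgroup.index_ker, MonoidHom.range_eq_top.2 hsurj, Subgroup.card_top, hQ] at h1
    have h8 : Nat.card Elem8 = 8 := by simp [Nat.card_eq_fintype_card]
    rw [h8] at h1
    omega
  obtain ⟨z, hz, huniq⟩ := (Nat.card_eq_two_iff' (1 : (f.comp Q.subtype).ker)).1 hcard
  refine ⟨z.1, z.1.2, fun hz1 => hz (Subtype.ext (Subtype.ext hz1)), z.2, fun q hq hfq => ?_⟩
  by_cases hq1 : q = 1
  · exact Or.inl hq1
  · right
    have := huniq ⟨⟨q, hq⟩, hfq⟩ (fun h' => hq1 (congrArg (fun x => x.1.1) h'))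
    exact congrArg (fun x => x.1.1) this

/-- Squares and commutators in `Q` lie in the kernel of `f`, hence in {1, z}, so bits record them.
Independence makes the 16 normal forms distinct, and by counting they exhaust `Q`. -/
theorem exists_frame {Q : Subgroup G} (hQ : Nat.card Q = 16) {a b c : G} (ha : a ∈ Q) (hb : b ∈ Q)
    (hc : c ∈ Q) (hat : a * t * a⁻¹ = t⁻¹) (hind : Indep3 (f a) (f b) (f c)) :
    ∃ (z : G) (D : QuadData), D.Frame t a b c z ∧ QState.ValInjective t a b c z ∧
      (D.ab || D.ac || D.bc) = true ∧ f z = 1 ∧ (D.xb = true → b * t * b⁻¹ = t⁻¹) ∧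
      (D.xc = true → c * t * c⁻¹ = t⁻¹) ∧ ∀ q ∈ Q, ∃ s, QState.val a b c z s = q := by
  obtain ⟨z, hzQ, hz1, hfz, hz⟩ := h.exists_involution hQ
  have hbit : ∀ q ∈ Q, f q = 1 → ∃ e : Bool, q = bif e then z else 1 := by
    intro q hq hfq
    rcases hz q hq hfq with rfl | rfl
    · exact ⟨false, rfl⟩
    · exact ⟨true, rfl⟩
  have hzcomm : ∀ q ∈ Q, Commute z q := by
    intro q hq
    rcases hz (q * z * q⁻¹) (Q.mul_mem (Q.mul_mem hq hzQ) (Q.inv_mem hq)) (by simp [hfz])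
      with h1 | h1
    · exact absurd (by simpa using h1) hz1
    · exact (mul_inv_eq_iff_eq_mul.1 h1).symm
  have hzz : z * z = 1 := by
    rcases hz (z * z) (Q.mul_mem hzQ hzQ) (by simp [hfz]) with h1 | h1
    · exact h1
    · exact absurd (by simpa using h1) hz1
  have hsq : ∀ q ∈ Q, ∃ e : Bool, q * q = bif e then z else 1 := fun q hq =>
    hbit _ (Q.mul_mem hq hq) (by rw [map_mul, Elem8.mul_self])
  have hcm : ∀ q ∈ Q, ∀ q' ∈ Q, ∃ e : Bool, q * q' = (bif e then z else 1) * (q' * q) := by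
    intro q hq q' hq'
    obtain ⟨e, he⟩ := hbit (q * q' * (q' * q)⁻¹)
      (Q.mul_mem (Q.mul_mem hq hq') (Q.inv_mem (Q.mul_mem hq' hq)))
      (by rw [map_mul, map_inv, map_mul, map_mul, mul_comm (f q'), mul_inv_cancel])
    exact ⟨e, mul_inv_eq_iff_eq_mul.1 he⟩
  have hsign : ∀ g : G, ∃ e : Bool, g * t * g⁻¹ = bif e then t⁻¹ else t := by
    intro g
    rcases h.conj_t g with h1 | h1
    · exact ⟨false, h1⟩
    · exact ⟨true, h1⟩
  obtain ⟨qa, hqa⟩ := hsq a ha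
  obtain ⟨qb, hqb⟩ := hsq b hb
  obtain ⟨qc, hqc⟩ := hsq c hc
  obtain ⟨ab, hab⟩ := hcm b hb a ha
  obtain ⟨ac, hac⟩ := hcm c hc a ha
  obtain ⟨bc, hbc⟩ := hcm c hc b hb
  obtain ⟨xb, hxb⟩ := hsign b
  obtain ⟨xc, hxc⟩ := hsign c
  have F : QuadData.Frame ⟨qa, qb, qc, ab, ac, bc, xb, xc⟩ t a b c z :=
    ⟨h.commute_of_f_eq_one hfz, hzcomm a ha, hzcomm b hb, hzcomm c hc, hzz, hqa, hqb, hqc, hab, hac,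
      hbc, hat, hxb, hxc⟩
  have hbitf : ∀ (g : G) i, f (bitPow g i) = bitPow (f g) i := by
    rintro g (_ | _) <;> simp [bitPow]
  have hbitQ : ∀ g ∈ Q, ∀ i, bitPow g i ∈ Q := by
    rintro g hg (_ | _)
    · exact Q.one_mem
    · exact hg
  have hfval : ∀ q : QState, f (QState.val a b c z q) =
      bitPow (f a) q.1 * bitPow (f b) q.2.1 * bitPow (f c) q.2.2.1 := by
    intro q
    have : ∀ i, bitPow (1 : Elem8) i = 1 := by rintro (_ | _) <;> rfl
    simp [QState.val, hbitf, hfz, this]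
  have hvalQ : ∀ q : QState, QState.val a b c z q ∈ Q := fun q =>
    Q.mul_mem (Q.mul_mem (Q.mul_mem (hbitQ z hzQ _) (hbitQ a ha _)) (hbitQ b hb _)) (hbitQ c hc _)
  have hinj : QState.ValInjective t a b c z := by
    intro n q q' hqq'
    have h1 := congrArg f hqq'
    rw [h.f_zpow_mul, hfval, hfval] at h1
    obtain ⟨i, j, k, l⟩ := q
    obtain ⟨i', j', k', l'⟩ := q'
    obtain ⟨rfl, rfl, rfl⟩ := hind.injective h1
    have ht : t ^ n ∈ Q := by
      rw [← mul_inv_eq_iff_eq_mul.2 hqq'.symm]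
      exact Q.mul_mem (hvalQ _) (Q.inv_mem (hvalQ _))
    rw [h.zpow_eq_one hQ ht, one_mul] at hqq'
    simp only [QState.val, mul_left_inj] at hqq'
    cases l <;> cases l' <;>
      first | rfl | exact absurd hqq' hz1 | exact absurd hqq'.symm hz1
  have hsurj : ∀ q ∈ Q, ∃ s, QState.val a b c z s = q := by
    have : Finite Q := Nat.finite_of_card_ne_zero (by rw [hQ]; decide)
    have := Fintype.ofFinite Q
    have hbij : Function.Bijective (fun s : QState => (⟨QState.val a b c z s, hvalQ s⟩ : Q)) := by
      rw [Fintype.bijective_iff_injective_and_card]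
      refine ⟨fun s s' hs => hinj 0 s s' ?_, ?_⟩
      · rw [zpow_zero, one_mul]
        exact congrArg Subtype.val hs
      · rw [← Nat.card_eq_fintype_card (α := Q), hQ]; rfl
    intro q hq
    obtain ⟨s, hs⟩ := hbij.2 ⟨q, hq⟩
    exact ⟨s, congrArg Subtype.val hs⟩
  refine ⟨z, _, F, hinj, ?_, hfz, ?_, ?_, hsurj⟩
  -- With all commutator bits zero `Q` would be abelian, forcing G' ≤ ⟨t⟩; but z ∈ G' ∩ Q is
  -- nontrivial.
  · by_contra hno
    simp only [Bool.not_eq_true, Bool.or_eq_false_iff] at hno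
    obtain ⟨⟨rfl, rfl⟩, rfl⟩ := hno
    have hcommQ : IsMulCommutative Q := by
      refine ⟨⟨?_⟩⟩
      rintro ⟨q, hq⟩ ⟨q', hq'⟩
      obtain ⟨s, rfl⟩ := hsurj q hq
      obtain ⟨s', rfl⟩ := hsurj q' hq'
      apply Subtype.ext
      simp only [Subgroup.coe_mul]
      rw [← F.val_mul, ← F.val_mul, QuadData.mul_comm_of_commute]
    have := h.normal
    have hle := Subgroup.Normal.commutator_le_of_self_sup_commutative_eq_top
      (h.isComplement' hQ).sup_eq_top hcommQ
    obtain ⟨n, hn⟩ := hle ((h.mem_commutator z).1 hfz)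
    simp only at hn
    exact hz1 (by rw [← hn]; exact h.zpow_eq_one hQ (by rw [hn]; exact hzQ))
  · intro hx; rw [hxb, show xb = true from hx]; rfl
  · intro hx; rw [hxc, show xc = true from hx]; rfl

theorem not_dvd_of_notMem {Q : Subgroup G} {n : ℤ} {q : G} (hq : q ∈ Q) (hn : t ^ n * q ∉ Q) :
    ¬ (p : ℤ) ∣ n := by
  intro hd
  rw [← h.orderOf_t, orderOf_dvd_iff_zpow_eq_one] at hd
  rw [hd, one_mul] at hn
  exact hn hq

/-- Some element of a generating set inverts `t`. -/
theorem exists_mem_conj_eq_inv {S : Set G} (hS : Subgroup.closure S = ⊤) {Q : Subgroup G}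
    (hQ : Nat.card Q = 16) : ∃ a ∈ S, a * t * a⁻¹ = t⁻¹ := by
  by_contra! hno
  have hcent : ∀ g : G, g * t = t * g := by
    have hle : S ⊆ Subgroup.centralizer {t} := by
      intro g hg
      rw [SetLike.mem_coe, Subgroup.mem_centralizer_singleton_iff]
      exact mul_inv_eq_iff_eq_mul.1 ((h.conj_t g).resolve_right (hno g hg))
    intro g
    have hg := (Subgroup.closure_le _).2 hle
    rw [hS] at hg
    exact Subgroup.mem_centralizer_singleton_iff.1 (hg (Subgroup.mem_top g))
  have hnormal : Q.Normal := by
    refine ⟨fun q hq g => ?_⟩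
    obtain ⟨n, r, hr, rfl⟩ := h.exists_eq_zpow_mul hQ g
    have hc : t ^ n * (r * q * r⁻¹) = r * q * r⁻¹ * t ^ n :=
      ((show Commute (r * q * r⁻¹) t from hcent _).zpow_right n).eq.symm
    rw [show t ^ n * r * q * (t ^ n * r)⁻¹ = t ^ n * (r * q * r⁻¹) * (t ^ n)⁻¹ by group, hc,
      mul_inv_cancel_right]
    exact Q.mul_mem (Q.mul_mem hr hq) (Q.inv_mem hr)
  -- With `t` central, `Q` is normal with abelian quotient, so `Q` contains G' and therefore `t`.
  have hle := Subgroup.Normal.commutator_le_of_self_sup_commutative_eq_top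
    (N := Q) (H := Subgroup.zpowers t) (h.isComplement' hQ).symm.sup_eq_top inferInstance
  have ht : t ^ (1 : ℤ) ∈ Q := by
    rw [zpow_one]; exact hle ((h.mem_commutator t).1 h.f_t)
  have := h.zpow_eq_one hQ ht
  rw [zpow_one, ← orderOf_eq_one_iff, h.orderOf_t] at this
  exact h.prime.one_lt.ne' this

/-- An element that inverts `t` lies in a complement of the normal subgroup. -/
theorem exists_complement_mem {a : G} (ha : a * t * a⁻¹ = t⁻¹) :
    ∃ Q : Subgroup G, Nat.card Q = 16 ∧ a ∈ Q := by
  have : Finite G := Nat.finite_of_card_ne_zero (by rw [h.card]; have := h.prime.pos; omega)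
  obtain ⟨Q, hQ⟩ := Sylow.exists_subgroup_card_pow_prime (G := G) 2 (n := 4)
    (by rw [h.card]; exact Dvd.intro _ rfl)
  obtain ⟨n, q, hq, rfl⟩ := h.exists_eq_zpow_mul hQ a
  obtain ⟨k, hk⟩ := h.odd
  -- Since `q` inverts `t`, conjugating `q` by `t ^ m` gives `t ^ (2 * m) * q`; with p = 2k + 1 this
  -- choice makes 2m = n(p + 1) ≡ n modulo p.
  set m := n * (k + 1) with hm
  refine ⟨Q.map (MulAut.conj (t ^ m)).toMonoidHom, ?_, q, hq, ?_⟩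
  · rw [Subgroup.card_map_of_injective (MulAut.conj (t ^ m)).injective, hQ]; rfl
  · have h1 : q * t * q⁻¹ = t⁻¹ := by
      have hc : Commute (t ^ n) t⁻¹ := ((Commute.refl t).zpow_left n).inv_right
      have h2 : q * t * q⁻¹ = (t ^ n)⁻¹ * (t ^ n * q * t * (t ^ n * q)⁻¹) * t ^ n := by group
      rw [h2, ha, mul_assoc, ← hc.eq, inv_mul_cancel_left]
    have h2 : q * (t ^ m)⁻¹ = t ^ m * q := by
      rw [← mul_inv_eq_iff_eq_mul, ← zpow_neg, ← conj_zpow, h1, inv_zpow, zpow_neg, inv_inv]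
    change t ^ m * q * (t ^ m)⁻¹ = t ^ n * q
    rw [mul_assoc, h2, ← mul_assoc, ← zpow_add]
    congr 1
    rw [zpow_eq_zpow_iff_modEq, h.orderOf_t]
    apply Int.ModEq.symm
    rw [Int.modEq_iff_dvd]
    exact ⟨n, by rw [hm, hk]; push_cast; ring⟩

/-! ### Case distinction on the generators -/

variable [Fintype G] [DecidableEq G]

theorem exists_isHamiltonianCycle_of_three {Q : Subgroup G} (hQ : Nat.card Q = 16) (S : Set G)
    {a b c : G} (ha : a ∈ S) (hb : b ∈ S) (hc : c ∈ S) (haQ : a ∈ Q) (hat : a * t * a⁻¹ = t⁻¹)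
    (hind : Indep3 (f a) (f b) (f c)) (hbc : ¬ (b ∈ Q ∧ c ∈ Q)) :
    ∃ (v : G) (c : (SimpleGraph.mulCayley S).Walk v v), c.IsHamiltonianCycle := by
  obtain ⟨m, b, hbQ, rfl⟩ := h.exists_eq_zpow_mul hQ b
  obtain ⟨n, c, hcQ, rfl⟩ := h.exists_eq_zpow_mul hQ c
  rw [h.f_zpow_mul, h.f_zpow_mul] at hind
  obtain ⟨z, D, F, hinj, hD, -⟩ := h.exists_frame hQ haQ hbQ hcQ hat hind
  refine F.exists_isHamiltonianCycle_of_three h.prime h.odd h.orderOf_t h.card hinj hD S ha hb hc ?_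
  rintro ⟨hm, hn⟩
  refine hbc ⟨?_, ?_⟩
  · by_contra hno; exact h.not_dvd_of_notMem hbQ hno hm
  · by_contra hno; exact h.not_dvd_of_notMem hcQ hno hn

/-- If the `Q`-part of `s` involves `c` or `b`, then `s` can replace that generator and the case of
three generators applies. Otherwise the `Q`-part is 1, z, a or az. -/
theorem exists_isHamiltonianCycle_of_complement {Q : Subgroup G} (hQ : Nat.card Q = 16) (S : Set G)
    {a b c s : G} (ha : a ∈ S) (hb : b ∈ S) (hc : c ∈ S) (hs : s ∈ S) (haQ : a ∈ Q) (hbQ : b ∈ Q)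
    (hcQ : c ∈ Q) (hsQ : s ∉ Q) (hat : a * t * a⁻¹ = t⁻¹) (hind : Indep3 (f a) (f b) (f c)) :
    ∃ (v : G) (c : (SimpleGraph.mulCayley S).Walk v v), c.IsHamiltonianCycle := by
  obtain ⟨z, D, F, hinj, hD, hfz, hxb, hxc, hsurj⟩ := h.exists_frame hQ haQ hbQ hcQ hat hind
  obtain ⟨n, q, hq, rfl⟩ := h.exists_eq_zpow_mul hQ s
  have hn := h.not_dvd_of_notMem hq hsQ
  obtain ⟨⟨i, j, k, l⟩, rfl⟩ := hsurj q hq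
  have hfs : f (t ^ n * QState.val a b c z (i, j, k, l)) =
      bitPow (f a) i * bitPow (f b) j * bitPow (f c) k := by
    have hbitf : ∀ (g : G) i, f (bitPow g i) = bitPow (f g) i := by
      rintro g (_ | _) <;> simp [bitPow]
    have : ∀ i, bitPow (1 : Elem8) i = 1 := by rintro (_ | _) <;> rfl
    rw [h.f_zpow_mul]
    simp [QState.val, hbitf, hfz, this]
  cases k with
  | true =>
    refine h.exists_isHamiltonianCycle_of_three hQ S ha hb hs haQ hat ?_ (fun h' => hsQ h'.2)
    rw [hfs]
    simpa only [bitPow_true] using Indep3.replace_third i j _ _ _ hind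
  | false =>
  cases j with
  | true =>
    refine h.exists_isHamiltonianCycle_of_three hQ S ha hs hc haQ hat ?_ (fun h' => hsQ h'.1)
    rw [hfs]
    simpa only [bitPow_true] using Indep3.replace_second i false _ _ _ hind
  | false =>
  cases i with
  | false =>
    cases l with
    | false =>
      refine F.exists_isHamiltonianCycle_of_mem_normal h.prime h.orderOf_t h.card hinj hD S ha hb hc
        hn ?_
      simpa [QState.val, bitPow] using hs
    | true =>
      refine F.exists_isHamiltonianCycle_of_four h.prime h.odd h.orderOf_t h.card hinj S ha hb hc
        hn hs ?_
      obtain ⟨qa, qb, qc, ab, ac, bc, xb, xc⟩ := D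
      exact checkFour_z_eq_true _ _ _ _ _ _ _ _ hD
  | true =>
    have hfa : f (t ^ n * QState.val a b c z (true, false, false, l)) = f a := by
      rw [hfs]; simp [bitPow]
    -- Now `s` and `a` have the same image in the abelianization. If `b` or `c` inverts `t`, it
    -- serves as the distinguished generator inside `Q`, and `s` replaces `a`.
    cases hb' : D.xb with
    | true =>
      refine h.exists_isHamiltonianCycle_of_three hQ S hb hs hc hbQ (hxb hb') ?_
        (fun h' => hsQ h'.1)
      rw [hfa]
      exact Indep3.swap_first_second _ _ _ hind
    | false =>
    cases hc' : D.xc with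
    | true =>
      refine h.exists_isHamiltonianCycle_of_three hQ S hc hb hs hcQ (hxc hc') ?_
        (fun h' => hsQ h'.2)
      rw [hfa]
      exact Indep3.swap_first_third _ _ _ hind
    | false =>
      refine F.exists_isHamiltonianCycle_of_four h.prime h.odd h.orderOf_t h.card hinj S ha hb hc
        hn hs ?_
      obtain ⟨qa, qb, qc, ab, ac, bc, xb, xc⟩ := D
      obtain rfl : xb = false := hb'
      obtain rfl : xc = false := hc'
      exact checkFour_a_eq_true _ _ _ _ _ _ _ hD

end NormalSetting

/-! ### Assembly -/

theorem mainTheorem5 {G : Type*} [Group G] [Fintype G] [DecidableEq G]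
    (p : ℕ) (hp : p.Prime) (hodd : Odd p)
    (hcard : Nat.card G = 16 * p)
    (P : Sylow p G) (hP : (P : Subgroup G).Normal)
    (hab : Nonempty ((G ⧸ commutator G) ≃* Multiplicative (ZMod 2 × ZMod 2 × ZMod 2)))
    (S : Set G) (hS : Subgroup.closure S = ⊤) :
    ∃ (v : G) (c : (SimpleGraph.mulCayley S).Walk v v), c.IsHamiltonianCycle := by
  obtain ⟨φ⟩ := hab
  have := Fact.mk hp
  set f : G →* Elem8 := φ.toMonoidHom.comp (QuotientGroup.mk' (commutator G)) with hf
  have hf1 : ∀ g : G, f g = 1 ↔ g ∈ commutator G := by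
    intro g
    simp [hf]
  have hsurj : Function.Surjective f :=
    φ.surjective.comp (QuotientGroup.mk'_surjective _)
  have hp2 : p ≠ 2 := by rintro rfl; exact absurd hodd (by decide)
  have hcop : Nat.Coprime p 16 := by
    have : Nat.Coprime p 2 := Nat.coprime_two_right.2 hodd
    simpa using this.pow_right 4
  have hPcard : Nat.card P = p := by
    rw [Sylow.card_eq_multiplicity, hcard, Nat.factorization_mul (by norm_num) hp.ne_zero]
    simp [hp.factorization_self,
      Nat.factorization_eq_zero_of_not_dvd ((Nat.Prime.coprime_iff_not_dvd hp).1 hcop)]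
  have hPcyc : IsCyclic P := isCyclic_of_prime_card hPcard
  obtain ⟨⟨t, htP⟩, htgen⟩ := hPcyc
  have ht : orderOf t = p := by
    rw [← hPcard, ← Subgroup.orderOf_mk t htP]
    exact orderOf_eq_card_of_forall_mem_zpowers htgen
  have hPt : (P : Subgroup G) = Subgroup.zpowers t := by
    apply le_antisymm
    · intro g hg
      obtain ⟨n, hn⟩ := htgen ⟨g, hg⟩
      exact ⟨n, congrArg Subtype.val hn⟩
    · rw [Subgroup.zpowers_le]; exact htP
  have h : NormalSetting p t f := ⟨hp, hodd, hcard, ht, hPt ▸ hP, hsurj, hf1⟩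
  obtain ⟨Q₀, hQ₀⟩ := Sylow.exists_subgroup_card_pow_prime (G := G) 2 (n := 4)
    (by rw [hcard]; exact Dvd.intro _ rfl)
  obtain ⟨a, ha, hat⟩ := h.exists_mem_conj_eq_inv hS hQ₀
  obtain ⟨Q, hQ, haQ⟩ := h.exists_complement_mem hat
  -- Elements of G' centralize `t`, whereas `a` inverts it and p is odd.
  have hfa : f a ≠ 1 := by
    intro h1
    rw [(h.commute_of_f_eq_one h1).eq, mul_inv_cancel_right] at hat
    have h2 : t ^ 2 = 1 := by rw [pow_two]; nth_rw 1 [hat]; exact inv_mul_cancel t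
    have h3 := orderOf_dvd_of_pow_eq_one h2
    rw [ht] at h3
    exact hp2 ((Nat.prime_dvd_prime_iff_eq hp Nat.prime_two).1 h3)
  -- Repeating `f a` yields an element outside the span of `f a` alone.
  obtain ⟨b, hb, hb1, hba, -⟩ := exists_mem_notMem_span hS hsurj (f a) (f a)
  obtain ⟨c, hc, hfc⟩ := exists_mem_notMem_span hS hsurj (f a) (f b)
  have hind := indep3_of_notMem _ _ _ hfa ⟨hb1, hba⟩ hfc
  by_cases hbc : b ∈ Q ∧ c ∈ Q
  · obtain ⟨s, hs, hsQ⟩ : ∃ s ∈ S, s ∉ Q := by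
      by_contra! hno
      have hle := (Subgroup.closure_le Q).2 hno
      rw [hS, top_le_iff] at hle
      rw [hle, Subgroup.card_top, hcard] at hQ
      have := hp.two_le
      omega
    exact h.exists_isHamiltonianCycle_of_complement hQ S ha hb hc hs haQ hbc.1 hbc.2 hsQ hat hind
  · exact h.exists_isHamiltonianCycle_of_three hQ S ha hb hc haQ hat hind hbc
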